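/- Let $\mathbb{R}_{\max}=\mathbb{R}\cup\{-\infty\}$ be the max-plus semiring ($a\oplus b=\max(a,b)$, $a\otimes b=a+b$), and let $\otimes$ also denote the induced matrix product, $(A\otimes B)_{ij}=\max_l(A_{il}+B_{lj})$. Let $k\ge 1$, let $\mathcal{M}_k$ be the set of $k\times k$ matrices with entries in $\mathbb{R}_{\max}$ and no row consisting only of $-\infty$, and let $\mathcal{P}_k\subset\mathcal{M}_k$ be the set of those $A\in\mathcal{M}_k$ such that $A^{\otimes n}$ has only finite entries for some $n\ge 1$. Equip $\mathcal{M}_k$ with the distance $d(A,B)=\max_{i,j}|\arctan(A_{ij})-\arctan(B_{ij})|$, where $\arctan(-\infty)=-\pi/2$, and with its Borel $\sigma$-algebra. An affine hyperplane of $\mathcal{P}_k$ is a set of the form $$\Big\{A\in\mathcal{P}_k \;\Big|\; A_{ij}\in\mathbb{R}\text{ whenever }\alpha_{ij}\neq 0,\ \text{ and } \sum_{\alpha_{ij}\ne 0}\alpha_{ij}A_{ij}=c\Big\}$$ with $c\in\mathbb{R}$ and $\alpha\in\mathbb{R}^{k\times k}$, $\alpha\neq 0$. A $k\times k$ matrix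 $A$ with entries in $\mathbb{R}_{\max}$ has rank 1 if there are $a,b\in\mathbb{R}_{\max}^k\setminus\{(-\infty)^k\}$ such that $A_{ij}=a_i+b_j$ for all $i,j$. A sequence $(A(n))_{n\in\mathbb{N}}$ of random matrices in $\mathcal{M}_k$ has the memory loss property (MLP) if there is an $N\ge 1$ such that $A(N)\otimes\cdots\otimes A(1)$ has rank 1 with positive probability. Let $\mu$ be a probability measure on $\mathcal{M}_k$ with support $S_\mu$, and assume that $S_\mu\cap\mathcal{P}_k$ is not included in a union of finitely many affine hyperplanes of $\mathcal{P}_k$. Then: 1. every sequence $(A(n))_{n\in\mathbb{N}}$ of independent random matrices with common law $\mu$ has the MLP; 2. every stationary sequence $(A(n))_{n\in\mathbb{N}}$ of random matrices in $\mathcal{M}_k$ such that $A(1)$ has law $\mu$ and, for every $N\in\mathbb{N}$, the product set $(S_\mu\cap\mathcal{P}_k)^N$ is included in the support of the law of $(A(1),\dots,A(N))$ has the MLP. -/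

import Mathlib

open MeasureTheory ProbabilityTheory

namespace MaxPlus

/-- The max-plus semiring `ℝ ∪ {-∞}`, carried by `WithBot ℝ`: the max-plus sum is the maximum `⊔`,
the max-plus product is `+` (with `⊥ + a = a + ⊥ = ⊥`), and `⊥` is `-∞`. -/
abbrev Rmax : Type := WithBot ℝ

/-- Square matrices of size `k` over the max-plus semiring. -/
abbrev Mat (k : ℕ) : Type := Matrix (Fin k) (Fin k) Rmax

/-- The max-plus product of matrices: `(A ⊗ B) i j = max_l (A i l + B l j)`. -/
noncomputable def mul {k : ℕ} (A B : Mat k) : Mat k :=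
  fun i j => Finset.univ.sup fun l => A i l + B l j

/-- The max-plus identity matrix. -/
noncomputable def one (k : ℕ) : Mat k :=
  fun i j => if i = j then 0 else ⊥

/-- The max-plus powers of a matrix. -/
noncomputable def pow {k : ℕ} (A : Mat k) : ℕ → Mat k
  | 0 => one k
  | n + 1 => mul A (pow A n)

/-- `A` has rank 1: there are two vectors `a`, `b`, neither of them identically `-∞`, such that
`A i j = a i + b j` for all `i`, `j`. -/
def RankOne {k : ℕ} (A : Mat k) : Prop :=
  ∃ a b : Fin k → Rmax, (∃ i, a i ≠ ⊥) ∧ (∃ j, b j ≠ ⊥) ∧ ∀ i j, A i j = a i + b j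

/-- The set `M_k` of `k × k` matrices over the max-plus semiring with no row of `-∞`. -/
@[ext]
structure M (k : ℕ) where
  /-- The underlying matrix. -/
  val : Mat k
  /-- No row consists only of `-∞`. -/
  row_ne : ∀ i, ∃ j, val i j ≠ ⊥

/-- The extension of `arctan` to `ℝ ∪ {-∞}`, with `arctan (-∞) = -π/2`. -/
noncomputable def arctan : Rmax → ℝ
  | ⊥ => -(Real.pi / 2)
  | (x : ℝ) => Real.arctan x

theorem arctan_injective : Function.Injective arctan := by
  intro x y h
  induction x using WithBot.recBotCoe with
  | bot =>
    induction y using WithBot.recBotCoe with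
    | bot => rfl
    | coe y => exact absurd h (Real.neg_pi_div_two_lt_arctan y).ne
  | coe x =>
    induction y using WithBot.recBotCoe with
    | bot => exact absurd h (Real.neg_pi_div_two_lt_arctan x).ne'
    | coe y => exact congrArg _ (Real.arctan_injective h)

/-- The matrix of the arctangents of the entries. -/
noncomputable def arctanEntries {k : ℕ} (A : M k) : Fin k → Fin k → ℝ :=
  fun i j => arctan (A.val i j)

theorem arctanEntries_injective (k : ℕ) :
    Function.Injective (arctanEntries : M k → Fin k → Fin k → ℝ) := by
  intro A B h
  ext1
  funext i j
  exact arctan_injective (congrFun (congrFun h i) j)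

/-- The distance `d(A, B) = max_{i,j} |arctan (A i j) - arctan (B i j)|` on `M_k`. -/
noncomputable instance (k : ℕ) : MetricSpace (M k) :=
  MetricSpace.induced arctanEntries (arctanEntries_injective k) inferInstance

/-- `M_k` carries its Borel σ-algebra. -/
noncomputable instance (k : ℕ) : MeasurableSpace (M k) := borel (M k)

instance (k : ℕ) : BorelSpace (M k) := ⟨rfl⟩

/-- The set `P_k` of primitive matrices: the elements of `M_k` some power of which has only finite
entries. -/
def P (k : ℕ) : Set (M k) :=
  {A | ∃ n : ℕ, 1 ≤ n ∧ ∀ i j, pow A.val n i j ≠ ⊥}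

open scoped Classical in
/-- The linear form `f_α` on `Rmax ^ Q` with coefficients `α ∈ ℝ ^ Q`: its value at `V` is the usual
sum of the `α i * V i` over the `i` with `α i ≠ 0` if all these `V i` are finite, and `-∞`
otherwise. -/
noncomputable def linearForm {Q : Type*} [Fintype Q] (α : Q → ℝ) (V : Q → Rmax) : Rmax :=
  if ∀ i, α i ≠ 0 → V i ≠ ⊥ then
    ((∑ i with α i ≠ 0, α i * (V i).unbotD 0 : ℝ) : Rmax)
  else ⊥

/-- Affine hyperplanes of `Rmax ^ Q`: the level sets, at finite levels, of nonzero linear forms. -/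
def IsAffineHyperplane {Q : Type*} [Fintype Q] (H : Set (Q → Rmax)) : Prop :=
  ∃ (α : Q → ℝ) (c : ℝ), α ≠ 0 ∧ H = {V | linearForm α V = (c : Rmax)}

/-- Affine hyperplanes of `P_k`: the intersections with `P_k` of the affine hyperplanes of the space
of all `k × k` matrices. -/
def IsAffineHyperplaneOfP {k : ℕ} (H : Set (M k)) : Prop :=
  ∃ K : Set (Fin k × Fin k → Rmax), IsAffineHyperplane K ∧
    H = {A | A ∈ P k ∧ (fun p : Fin k × Fin k => A.val p.1 p.2) ∈ K}

/-- The product `A(N) ⊗ ⋯ ⊗ A(1)`. -/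
noncomputable def prod {k : ℕ} (A : ℕ → M k) : ℕ → Mat k
  | 0 => one k
  | N + 1 => mul (A (N + 1)).val (prod A N)

variable {Ω : Type*} [MeasurableSpace Ω]

/-- The memory loss property: for some `N ≥ 1`, the product `A(N) ⊗ ⋯ ⊗ A(1)` has rank 1 with
positive probability. -/
def MLP {k : ℕ} (Pr : Measure Ω) (A : ℕ → Ω → M k) : Prop :=
  ∃ N : ℕ, 1 ≤ N ∧ 0 < Pr {ω | RankOne (prod (fun n => A n ω) N)}

/-- The sequence `A` is stationary: the shifted sequence has the same law, as a random element of
the sequence space. -/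
def IsStationary {E : Type*} [MeasurableSpace E] (Pr : Measure Ω) (A : ℕ → Ω → E) : Prop :=
  IdentDistrib (fun ω n => A (n + 1) ω) (fun ω n => A n ω) Pr Pr

/-- The law of `(A(1), …, A(N))`, a measure on the product of `N` copies of the state space. -/
noncomputable def lawUpTo {E : Type*} [MeasurableSpace E] (Pr : Measure Ω) (A : ℕ → Ω → E) (N : ℕ) :
    Measure (Fin N → E) :=
  Pr.map fun ω i => A ((i : ℕ) + 1) ω

end MaxPlus

/-!
Rank one is forced, and forced robustly, by a bottleneck. If there are words `w₁`, `w₂` in the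
matrices and a vertex `d` such that all the optimal walks along `w₁ ++ w₂`, whatever their ends, pass
through `d` between `w₁` and `w₂`, then the product has entries `a i + b j`, where `a` is column `d`
of the first product and `b` is row `d` of the second one. When the optimality is strict, this is
an open condition on the matrices (`exists_isOpen_rankOne`): in the coordinates `exp`, with
`exp (-∞) = 0`, the entries of a product are maxima of products of nonnegative numbers, hence
continuous. An open condition satisfied at a point of the support has positive probability
(`MLP.of_subset_support`); an independent sequence satisfies the support condition by
`mem_support_lawUpTo`.

It remains to find the words in the set `S` of primitive matrices of the support.

* Since `S` is not covered by finitely many hyperplanes, it contains a matrix `A` that satisfies none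
  of the finitely many integer linear relations with small coefficients. Let `r` be its maximal cycle
  mean and `c` a vertex on a cycle that attains it. A short closed walk of mean `r` that avoids `c`
  would give such a relation, so all of these have smaller mean (`IsGeneric.closed_lt`). Hence a long
  walk has to visit `c` to be competitive, and for large `N` the power `A ^ N` is bounded by
  `N * r + u i + v j`, with equality at any prescribed `(i, j)` for infinitely many `N`
  (`IsGeneric.exists_potentials`).
* The quantities `v l + B l j + u j` are pairwise distinct for `B` outside finitely many hyperplanes,
  which depend on `u` and `v`, thus on `A`. Choose such a `B` in `S`, let `(l₀, d)` be the place of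
  their maximum, and choose `N` such that the bound on `A ^ N` is sharp at `(d, l₀)`. Then, after a
  diagonal change of coordinates and a normalization, `D = A ^ N ⊗ B` has the entry `0` at `(d, d)`,
  no positive entry, and entries at most `-δ` outside column `d` (`exists_hasDominantLoop`).
* Along high powers of `D` the optimal walks stay at `d` most of the time, and leaving it in
  the middle costs at least `δ`: the words for `D ^ n` and `D ^ n ⊗ A ^ n₀` are as wanted
  (`HasDominantLoop.exists_separating`, `exists_separating_words`).
-/

namespace MaxPlus

/-! ### Walks and their weights -/

/-- `IsWalk [A₁, …, Aₙ] i j x` says that some walk `i = i₀, i₁, …, iₙ = j` has all its steps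
`A_t i_{t-1} i_t` finite, with sum `x`. Restricting to finite weights keeps all the estimates on
walks inside `ℝ`. -/
def IsWalk {k : ℕ} : List (Mat k) → Fin k → Fin k → ℝ → Prop
  | [], i, j, x => i = j ∧ x = 0
  | A :: w, i, j, x => ∃ (l : Fin k) (y z : ℝ), A i l = (y : Rmax) ∧ IsWalk w l j z ∧ x = y + z

/-- The max-plus product of a list of matrices. -/
noncomputable def listProd {k : ℕ} (w : List (Mat k)) : Mat k :=
  w.foldr mul (one k)

section Walks

variable {k : ℕ}

theorem listProd_cons (A : Mat k) (w : List (Mat k)) : listProd (A :: w) = mul A (listProd w) :=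
  rfl

theorem le_mul (A B : Mat k) (i l j : Fin k) : A i l + B l j ≤ mul A B i j :=
  Finset.le_sup (f := fun l => A i l + B l j) (Finset.mem_univ l)

theorem exists_mul_eq (A B : Mat k) (i j : Fin k) : ∃ l, mul A B i j = A i l + B l j := by
  obtain ⟨l, -, h⟩ := Finset.exists_mem_eq_sup Finset.univ ⟨i, Finset.mem_univ i⟩
    (fun l => A i l + B l j)
  exact ⟨l, h⟩

theorem IsWalk.le_listProd {w : List (Mat k)} {i j : Fin k} {x : ℝ} (h : IsWalk w i j x) :
    (x : Rmax) ≤ listProd w i j := by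
  induction w generalizing i x with
  | nil =>
    obtain ⟨rfl, rfl⟩ := h
    simp [listProd, one]
  | cons A w ih =>
    obtain ⟨l, y, z, hy, hz, rfl⟩ := h
    refine le_trans ?_ (le_mul A (listProd w) i l j)
    rw [hy, WithBot.coe_add]
    gcongr
    exact ih hz

theorem IsWalk.of_listProd_eq {w : List (Mat k)} {i j : Fin k} {x : ℝ}
    (h : listProd w i j = (x : Rmax)) : IsWalk w i j x := by
  induction w generalizing i x with
  | nil =>
    by_cases hij : i = j
    · refine ⟨hij, ?_⟩
      have h' : ((0 : ℝ) : Rmax) = x := by simpa [listProd, one, hij] using h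
      exact (WithBot.coe_injective h').symm
    · simp [listProd, one, hij] at h
  | cons A w ih =>
    obtain ⟨l, hl⟩ := exists_mul_eq A (listProd w) i j
    rw [listProd_cons, hl, WithBot.add_eq_coe] at h
    obtain ⟨y, z, hy, hz, rfl⟩ := h
    exact ⟨l, y, z, hy.symm, ih hz.symm, rfl⟩

theorem exists_isWalk_iff {w : List (Mat k)} {i j : Fin k} :
    (∃ x, IsWalk w i j x) ↔ listProd w i j ≠ ⊥ := by
  constructor
  · rintro ⟨x, hx⟩ h
    simpa [h] using hx.le_listProd
  · intro h
    obtain ⟨x, hx⟩ := WithBot.ne_bot_iff_exists.1 h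
    exact ⟨x, .of_listProd_eq hx.symm⟩

theorem IsWalk.append {w₁ w₂ : List (Mat k)} {i l j : Fin k} {x y : ℝ} (h₁ : IsWalk w₁ i l x)
    (h₂ : IsWalk w₂ l j y) : IsWalk (w₁ ++ w₂) i j (x + y) := by
  induction w₁ generalizing i x with
  | nil =>
    obtain ⟨rfl, rfl⟩ := h₁
    simpa using h₂
  | cons A w₁ ih =>
    obtain ⟨m, a, b, ha, hb, rfl⟩ := h₁
    exact ⟨m, a, b + y, ha, ih hb, by ring⟩

theorem IsWalk.exists_of_append {w₁ w₂ : List (Mat k)} {i j : Fin k} {x : ℝ}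
    (h : IsWalk (w₁ ++ w₂) i j x) :
    ∃ l y z, IsWalk w₁ i l y ∧ IsWalk w₂ l j z ∧ x = y + z := by
  induction w₁ generalizing i x with
  | nil => exact ⟨i, 0, x, ⟨rfl, rfl⟩, h, by ring⟩
  | cons A w₁ ih =>
    obtain ⟨m, a, b, ha, hb, rfl⟩ := h
    obtain ⟨l, y, z, hy, hz, rfl⟩ := ih hb
    exact ⟨l, a + y, z, ⟨m, a, y, ha, hy, rfl⟩, hz, by ring⟩

theorem isWalk_singleton {A : Mat k} {i j : Fin k} {x : ℝ} :
    IsWalk [A] i j x ↔ A i j = (x : Rmax) := by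
  constructor
  · rintro ⟨l, y, z, hy, ⟨rfl, rfl⟩, rfl⟩
    simpa using hy
  · intro h
    exact ⟨j, x, 0, h, ⟨rfl, rfl⟩, by ring⟩

theorem finite_isWalk (w : List (Mat k)) (i j : Fin k) : {x | IsWalk w i j x}.Finite := by
  induction w generalizing i with
  | nil => exact (Set.finite_singleton (0 : ℝ)).subset fun x hx => hx.2
  | cons A w ih =>
    refine (Set.finite_iUnion fun l => (ih l).image fun z => (A i l).unbotD 0 + z).subset ?_
    rintro x ⟨l, y, z, hy, hz, rfl⟩
    exact Set.mem_iUnion.2 ⟨l, z, hz, by simp [hy]⟩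

theorem listProd_replicate (A : Mat k) (n : ℕ) : listProd (List.replicate n A) = pow A n := by
  induction n with
  | zero => rfl
  | succ n ih => rw [List.replicate_succ, listProd_cons, ih]; rfl

theorem IsWalk.replicate_add {A : Mat k} {m n : ℕ} {i l j : Fin k} {x y : ℝ}
    (h₁ : IsWalk (List.replicate m A) i l x) (h₂ : IsWalk (List.replicate n A) l j y) :
    IsWalk (List.replicate (m + n) A) i j (x + y) := by
  rw [List.replicate_add]
  exact h₁.append h₂

theorem IsWalk.replicate_mul {A : Mat k} {p : ℕ} {c : Fin k} {x : ℝ}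
    (h : IsWalk (List.replicate p A) c c x) (t : ℕ) :
    IsWalk (List.replicate (t * p) A) c c (t * x) := by
  induction t with
  | zero => simp [IsWalk]
  | succ t ih =>
    have := ih.replicate_add h
    rw [Nat.succ_mul, Nat.cast_succ, add_mul, one_mul]
    exact this

/-- In powers of a matrix with no row of `-∞`, an entry that can be reached stays reachable from
everywhere in any larger number of steps. -/
theorem exists_isWalk_replicate_of_le {A : Mat k} (hA : ∀ i, ∃ j, A i j ≠ ⊥) {j : Fin k} {m n : ℕ}
    (hmn : m ≤ n) (h : ∀ i, ∃ x, IsWalk (List.replicate m A) i j x) (i : Fin k) :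
    ∃ x, IsWalk (List.replicate n A) i j x := by
  induction n, hmn using Nat.le_induction generalizing i with
  | base => exact h i
  | succ n _ ih =>
    obtain ⟨l, hl⟩ := hA i
    obtain ⟨y, hy⟩ := WithBot.ne_bot_iff_exists.1 hl
    obtain ⟨z, hz⟩ := ih l
    exact ⟨y + z, l, y, z, hy.symm, hz, rfl⟩

/-! ### Cutting closed walks out of long walks -/

/-- The vertices `f t` and the partial weights `g t` of a walk along powers of a single matrix. -/
theorem IsWalk.exists_trace {A : Mat k} {n : ℕ} {i j : Fin k} {x : ℝ}
    (h : IsWalk (List.replicate n A) i j x) :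
    ∃ (f : ℕ → Fin k) (g : ℕ → ℝ), f 0 = i ∧ f n = j ∧ g 0 = 0 ∧ g n = x ∧
      ∀ t < n, A (f t) (f (t + 1)) = ((g (t + 1) - g t : ℝ) : Rmax) := by
  induction n generalizing i x with
  | zero =>
    obtain ⟨rfl, rfl⟩ := h
    exact ⟨fun _ => i, fun _ => 0, rfl, rfl, rfl, rfl, by simp⟩
  | succ n ih =>
    obtain ⟨l, y, z, hy, hz, rfl⟩ := h
    obtain ⟨f, g, rfl, hfn, hg0, hgn, hfg⟩ := ih hz
    refine ⟨fun t => Nat.casesOn t i f, fun t => Nat.casesOn t 0 fun s => y + g s, rfl, hfn, rfl,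
      by simp [hgn], ?_⟩
    rintro (_ | t) ht
    · simpa [hg0] using hy
    · simpa using hfg t (by omega)

theorem isWalk_of_trace {A : Mat k} {f : ℕ → Fin k} {g : ℕ → ℝ} (n s : ℕ)
    (h : ∀ t, s ≤ t → t < s + n → A (f t) (f (t + 1)) = ((g (t + 1) - g t : ℝ) : Rmax)) :
    IsWalk (List.replicate n A) (f s) (f (s + n)) (g (s + n) - g s) := by
  induction n generalizing s with
  | zero => exact ⟨rfl, by simp⟩
  | succ n ih =>
    have h' := ih (s + 1) fun t h₁ h₂ => h t (by omega) (by omega)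
    rw [add_right_comm, add_assoc] at h'
    exact ⟨f (s + 1), _, _, h s le_rfl (by omega), h', by ring⟩

/-- A walk of length at least `k` contains a closed walk of length between `1` and `k`. -/
theorem IsWalk.exists_closed {A : Mat k} {n : ℕ} {i j : Fin k} {x : ℝ} (hn : k ≤ n)
    (h : IsWalk (List.replicate n A) i j x) :
    ∃ (a b d : ℕ) (l : Fin k) (x₁ x₂ x₃ : ℝ), 1 ≤ b ∧ b ≤ k ∧ n = a + b + d ∧ x = x₁ + x₂ + x₃ ∧
      IsWalk (List.replicate a A) i l x₁ ∧ IsWalk (List.replicate b A) l l x₂ ∧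
      IsWalk (List.replicate d A) l j x₃ := by
  obtain ⟨f, g, hf0, hfn, hg0, hgn, hfg⟩ := h.exists_trace
  obtain ⟨s, t, hst, htk, hfst⟩ : ∃ s t : ℕ, s < t ∧ t ≤ k ∧ f s = f t := by
    obtain ⟨s, t, hne, heq⟩ := Fintype.exists_ne_map_eq_of_card_lt
      (fun s : Fin (k + 1) => f s) (by simp)
    rcases lt_or_gt_of_ne hne with h | h
    · exact ⟨s, t, h, by omega, heq⟩
    · exact ⟨t, s, h, by omega, heq.symm⟩
  obtain ⟨b, rfl⟩ := Nat.exists_eq_add_of_lt hst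
  obtain ⟨d, rfl⟩ := Nat.exists_eq_add_of_le (htk.trans hn)
  have h₁ := isWalk_of_trace (A := A) (f := f) (g := g) s 0 fun t _ ht => hfg t (by omega)
  have h₂ := isWalk_of_trace (A := A) (f := f) (g := g) (b + 1) s fun t _ ht => hfg t (by omega)
  have h₃ := isWalk_of_trace (A := A) (f := f) (g := g) d (s + b + 1)
    fun t _ ht => hfg t (by omega)
  simp only [zero_add, hf0] at h₁
  rw [← add_assoc, ← hfst] at h₂
  rw [← hfst, hfn] at h₃
  exact ⟨s, b + 1, d, f s, _, _, _, by omega, by omega, by omega, by rw [← hgn, hg0]; ring,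
    h₁, h₂, h₃⟩

/-- If the short closed walks have mean weight at most `r`, then every walk can be shortened to
length less than `k` without lowering its weight, when `r` is subtracted at each step. -/
theorem IsWalk.exists_short {A : Mat k} {r : ℝ}
    (hr : ∀ b l y, 1 ≤ b → b ≤ k → IsWalk (List.replicate b A) l l y → y ≤ b * r)
    {n : ℕ} {i j : Fin k} {x : ℝ} (h : IsWalk (List.replicate n A) i j x) :
    ∃ m < k, ∃ y, IsWalk (List.replicate m A) i j y ∧ x - n * r ≤ y - m * r := by
  induction n using Nat.strong_induction_on generalizing x with
  | _ n ih =>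
    rcases lt_or_ge n k with hn | hn
    · exact ⟨n, hn, x, h, le_rfl⟩
    · obtain ⟨a, b, d, l, x₁, x₂, x₃, hb, hbk, rfl, rfl, h₁, h₂, h₃⟩ := h.exists_closed hn
      obtain ⟨m, hm, y, hy, hle⟩ := ih (a + d) (by omega) (h₁.replicate_add h₃)
      refine ⟨m, hm, y, hy, ?_⟩
      have := hr b l x₂ hb hbk h₂
      push_cast at hle ⊢
      linarith

theorem finite_short (A : Mat k) (r : ℝ) (i j : Fin k) (K : ℕ) :
    {z : ℝ | ∃ m < K, ∃ y, IsWalk (List.replicate m A) i j y ∧ z = y - m * r}.Finite := by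
  refine ((Set.finite_Iio K).biUnion fun m _ =>
    (finite_isWalk (List.replicate m A) i j).image fun y => y - m * r).subset ?_
  rintro z ⟨m, hm, y, hy, rfl⟩
  exact Set.mem_biUnion (x := m) hm ⟨y, hy, rfl⟩

/-- If the short closed walks have mean weight at most `r`, then the weights of the walks from `i`
to `j`, with `r` subtracted at each step, have a maximum. -/
theorem exists_max_weight {A : Mat k} {r : ℝ}
    (hr : ∀ b l y, 1 ≤ b → b ≤ k → IsWalk (List.replicate b A) l l y → y ≤ b * r)
    {i j : Fin k} (h : ∃ n x, IsWalk (List.replicate n A) i j x) :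
    ∃ (v : ℝ) (m : ℕ), IsWalk (List.replicate m A) i j (v + m * r) ∧
      ∀ n x, IsWalk (List.replicate n A) i j x → x - n * r ≤ v := by
  obtain ⟨n, x, hx⟩ := h
  obtain ⟨m, hm, y, hy, -⟩ := hx.exists_short hr
  obtain ⟨_, ⟨m, hm, y, hy, rfl⟩, hmax⟩ :=
    Set.exists_max_image _ id (finite_short A r i j k) ⟨_, m, hm, y, hy, rfl⟩
  refine ⟨y - m * r, m, by simpa using hy, fun n x hx => ?_⟩
  obtain ⟨m', hm', y', hy', hle⟩ := hx.exists_short hr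
  exact hle.trans (hmax _ ⟨m', hm', y', hy', rfl⟩)

theorem exists_forall_weight_le {A : Mat k} {r : ℝ}
    (hr : ∀ b l y, 1 ≤ b → b ≤ k → IsWalk (List.replicate b A) l l y → y ≤ b * r) :
    ∃ C : ℝ, ∀ n i j x, IsWalk (List.replicate n A) i j x → x ≤ C + n * r := by
  obtain ⟨C, hC⟩ := (Set.finite_iUnion fun i => Set.finite_iUnion fun j =>
    finite_short A r i j k).bddAbove
  refine ⟨C, fun n i j x hx => ?_⟩
  obtain ⟨m, hm, y, hy, hle⟩ := hx.exists_short hr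
  have := hC (Set.mem_iUnion.2 ⟨i, Set.mem_iUnion.2 ⟨j, m, hm, y, hy, rfl⟩⟩)
  linarith

/-! ### The matrix with a vertex deleted -/

/-- The matrix obtained from `A` by deleting the vertex `c`: its row and its column become `-∞`. -/
noncomputable def deleteVertex (A : Mat k) (c : Fin k) : Mat k :=
  fun i j => if i = c ∨ j = c then ⊥ else A i j

theorem deleteVertex_eq_coe {A : Mat k} {c i j : Fin k} {x : ℝ} :
    deleteVertex A c i j = (x : Rmax) ↔ i ≠ c ∧ j ≠ c ∧ A i j = (x : Rmax) := by
  unfold deleteVertex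
  split_ifs with h
  · simp; tauto
  · simp; tauto

/-- A walk along the powers of `A` avoids `c` or passes through `c`. -/
theorem IsWalk.deleteVertex_or {A : Mat k} (c : Fin k) {n : ℕ} {i j : Fin k} {x : ℝ}
    (h : IsWalk (List.replicate n A) i j x) :
    IsWalk (List.replicate n (deleteVertex A c)) i j x ∨
      ∃ (a b : ℕ) (y z : ℝ), n = a + b ∧ x = y + z ∧ IsWalk (List.replicate a A) i c y ∧
        IsWalk (List.replicate b A) c j z := by
  induction n generalizing i x with
  | zero => exact Or.inl h
  | succ n ih =>
    by_cases hi : i = c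
    · subst hi
      exact Or.inr ⟨0, n + 1, 0, x, by omega, by ring, ⟨rfl, rfl⟩, h⟩
    obtain ⟨l, y, z, hy, hz, rfl⟩ := h
    have hyw : IsWalk (List.replicate 1 A) i l y := isWalk_singleton.2 hy
    by_cases hl : l = c
    · subst hl
      exact Or.inr ⟨1, n, y, z, by omega, rfl, hyw, hz⟩
    rcases ih hz with h' | ⟨a, b, y', z', rfl, rfl, h₁, h₂⟩
    · exact Or.inl ⟨l, y, z, deleteVertex_eq_coe.2 ⟨hi, hl, hy⟩, h', rfl⟩
    · exact Or.inr ⟨1 + a, b, y + y', z', by omega, by ring, hyw.replicate_add h₁, h₂⟩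

/-- The numbers of passages through the edges along a walk: the weight is a linear form in the
entries of the matrix, with these numbers as coefficients. -/
theorem IsWalk.exists_count {A : Mat k} {n : ℕ} {i j : Fin k} {x : ℝ}
    (h : IsWalk (List.replicate n A) i j x) :
    ∃ v : Fin k × Fin k → ℕ, (∀ e, v e ≤ n) ∧ (∀ e, v e ≠ 0 → A e.1 e.2 ≠ ⊥) ∧
      (1 ≤ n → ∃ l, v (i, l) ≠ 0) ∧ x = ∑ e, (v e : ℝ) * (A e.1 e.2).unbotD 0 := by
  classical
  induction n generalizing i x with
  | zero =>
    obtain ⟨rfl, rfl⟩ := h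
    exact ⟨fun _ => 0, by simp, by simp, by simp, by simp⟩
  | succ n ih =>
    obtain ⟨l, y, z, hy, hz, rfl⟩ := h
    obtain ⟨v, hv₁, hv₂, -, rfl⟩ := ih hz
    refine ⟨v + Pi.single (i, l) 1, fun e => ?_, fun e he => ?_, fun _ => ⟨l, by simp⟩, ?_⟩
    · have := hv₁ e
      by_cases hel : e = (i, l)
      · subst hel; simpa using this
      · simpa [hel] using this.trans n.le_succ
    · by_cases hel : e = (i, l)
      · subst hel; simp [hy]
      · exact hv₂ e (by simpa [hel] using he)
    · simp [add_mul, Finset.sum_add_distrib, Pi.single_apply, hy, add_comm]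

end Walks

section Words

variable {k : ℕ}

/-! ### Long powers of a generic matrix -/

theorem exists_lt_forall_le {s : Set ℝ} (hs : s.Finite) {r : ℝ} (h : ∀ x ∈ s, x < r) :
    ∃ r' < r, ∀ x ∈ s, x ≤ r' := by
  rcases s.eq_empty_or_nonempty with rfl | hne
  · exact ⟨r - 1, by linarith, by simp⟩
  · obtain ⟨a, ha, hmax⟩ := Set.exists_max_image s id hs hne
    exact ⟨a, h a ha, hmax⟩

theorem finite_closed_means (A : Mat k) : {z : ℝ | ∃ (b : ℕ) (l : Fin k) (y : ℝ), 1 ≤ b ∧ b ≤ k ∧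
    IsWalk (List.replicate b A) l l y ∧ z = y / b}.Finite := by
  refine ((Set.finite_Iic k).biUnion fun b _ => Set.finite_iUnion fun l =>
    (finite_isWalk (List.replicate b A) l l).image fun y => y / (b : ℝ)).subset ?_
  rintro z ⟨b, l, y, -, hb, hy, rfl⟩
  exact Set.mem_biUnion (x := b) hb (Set.mem_iUnion.2 ⟨l, y, hy, rfl⟩)

/-- The maximal mean weight `r` of the short closed walks, and a closed walk that attains it. -/
theorem exists_max_mean {A : Mat k} {i j : Fin k} {n : ℕ} {x : ℝ} (hn : k ≤ n)
    (h : IsWalk (List.replicate n A) i j x) :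
    ∃ (r : ℝ) (c : Fin k) (p : ℕ), 1 ≤ p ∧ p ≤ k ∧ IsWalk (List.replicate p A) c c (p * r) ∧
      ∀ b l y, 1 ≤ b → b ≤ k → IsWalk (List.replicate b A) l l y → y ≤ b * r := by
  obtain ⟨-, b, -, l, -, y, -, hb, hbk, -, -, -, hy, -⟩ := h.exists_closed hn
  obtain ⟨_, ⟨p, c, y, hp, hpk, hy, rfl⟩, hmax⟩ :=
    Set.exists_max_image _ id (finite_closed_means A) ⟨_, b, l, y, hb, hbk, hy, rfl⟩
  have hp' : (0 : ℝ) < p := by exact_mod_cast hp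
  refine ⟨y / p, c, p, hp, hpk, by rwa [mul_div_cancel₀ _ hp'.ne'], fun b l z hb hbk hz => ?_⟩
  have hb' : (0 : ℝ) < b := by exact_mod_cast hb
  have : z / b ≤ y / p := hmax _ ⟨b, l, z, hb, hbk, hz, rfl⟩
  rwa [div_le_iff₀' hb'] at this

theorem linearForm_eq_sum {Q : Type*} [Fintype Q] {α : Q → ℝ} {V : Q → Rmax}
    (h : ∀ i, α i ≠ 0 → V i ≠ ⊥) :
    linearForm α V = ((∑ i, α i * (V i).unbotD 0 : ℝ) : Rmax) := by
  classical
  rw [linearForm, if_pos h, Finset.sum_filter]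
  congr 1
  refine Finset.sum_congr rfl fun i _ => ?_
  by_cases hi : α i = 0 <;> simp [hi]

/-- `A` lies on no hyperplane through the origin with integer coefficients bounded by `k ^ 2`. The
bound covers the relations `p • V - b • W` for `V`, `W` the vectors that count the passages through
the edges along walks of lengths `b`, `p ≤ k`. -/
def IsGeneric (A : Mat k) : Prop :=
  ∀ α : Fin k × Fin k → ℤ, α ∈ Set.Icc (fun _ => -((k : ℤ) * k)) (fun _ => (k : ℤ) * k) → α ≠ 0 →
    linearForm (fun e => (α e : ℝ)) (fun e => A e.1 e.2) ≠ ((0 : ℝ) : Rmax)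

/-- If `c` lies on a closed walk of maximal mean weight `r`, then for a generic matrix the closed
walks that avoid `c` have smaller mean weight: otherwise `p` times the counting vector of the second
walk minus `b` times that of the first one is the vector of coefficients of a hyperplane through
`A`, and it does not vanish on the edges out of `c`. -/
theorem IsGeneric.closed_lt {A : Mat k} (hA : IsGeneric A) {r : ℝ} {c : Fin k} {p : ℕ} (hp : 1 ≤ p)
    (hpk : p ≤ k) (hc : IsWalk (List.replicate p A) c c (p * r))
    (hr : ∀ b l y, 1 ≤ b → b ≤ k → IsWalk (List.replicate b A) l l y → y ≤ b * r)
    {b : ℕ} {l : Fin k} {y : ℝ} (hb : 1 ≤ b) (hbk : b ≤ k)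
    (hy : IsWalk (List.replicate b (deleteVertex A c)) l l y) : y < b * r := by
  obtain ⟨v, hv, hvA, hvc, hvw⟩ := hc.exists_count
  obtain ⟨w, hw, hwA, -, hww⟩ := hy.exists_count
  have hwA' : ∀ e, w e ≠ 0 → e.1 ≠ c ∧ e.2 ≠ c ∧ A e.1 e.2 ≠ ⊥ := by
    intro e he
    obtain ⟨z, hz⟩ := WithBot.ne_bot_iff_exists.1 (hwA e he)
    obtain ⟨h₁, h₂, h₃⟩ := deleteVertex_eq_coe.1 hz.symm
    exact ⟨h₁, h₂, by simp [h₃]⟩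
  have hww' : y = ∑ e, (w e : ℝ) * (A e.1 e.2).unbotD 0 := by
    rw [hww]
    refine Finset.sum_congr rfl fun e _ => ?_
    by_cases he : w e = 0
    · simp [he]
    · obtain ⟨h₁, h₂, -⟩ := hwA' e he
      simp [deleteVertex, h₁, h₂]
  have hle : y ≤ b * r := by
    obtain ⟨f, g, hf0, hfb, hg0, hgb, hfg⟩ := hy.exists_trace
    have := isWalk_of_trace (A := A) (f := f) (g := g) b 0
      fun t _ ht => (deleteVertex_eq_coe.1 (hfg t (by omega))).2.2
    simp only [zero_add, hf0, hfb, hg0, hgb, sub_zero] at this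
    exact hr b l y hb hbk this
  refine hle.lt_of_ne fun heq => ?_
  refine hA (fun e => (p : ℤ) * w e - (b : ℤ) * v e) ⟨fun e => ?_, fun e => ?_⟩ (fun h0 => ?_) ?_
  · have h₁ : (b : ℤ) * v e ≤ k * k := by
      exact_mod_cast Nat.mul_le_mul hbk ((hv e).trans hpk)
    have h₂ : (0 : ℤ) ≤ p * w e := by positivity
    show -((k : ℤ) * k) ≤ _
    linarith
  · have h₁ : (p : ℤ) * w e ≤ k * k := by
      exact_mod_cast Nat.mul_le_mul hpk ((hw e).trans hbk)
    have h₂ : (0 : ℤ) ≤ b * v e := by positivity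
    show _ ≤ (k : ℤ) * k
    linarith
  · obtain ⟨m, hm⟩ := hvc hp
    have hwm : w (c, m) = 0 := by
      by_contra h
      exact (hwA' _ h).1 rfl
    have := congrFun h0 (c, m)
    simp [hwm, hm] at this
    omega
  · have hfin : ∀ e, (((p : ℤ) * w e - (b : ℤ) * v e : ℤ) : ℝ) ≠ 0 → A e.1 e.2 ≠ ⊥ := by
      intro e he
      by_cases hwe : w e = 0
      · refine hvA e fun hve => he ?_
        simp [hwe, hve]
      · exact (hwA' e hwe).2.2
    rw [linearForm_eq_sum hfin]
    congr 1
    calc ∑ e, (((p : ℤ) * w e - (b : ℤ) * v e : ℤ) : ℝ) * (A e.1 e.2).unbotD 0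
        = p * ∑ e, (w e : ℝ) * (A e.1 e.2).unbotD 0
          - b * ∑ e, (v e : ℝ) * (A e.1 e.2).unbotD 0 := by
          rw [Finset.mul_sum, Finset.mul_sum, ← Finset.sum_sub_distrib]
          refine Finset.sum_congr rfl fun e _ => ?_
          push_cast
          ring
      _ = 0 := by
          rw [← hww', ← hvw, heq]
          ring

/-- Large powers of a generic primitive matrix are bounded by a matrix of rank one, up to the
factor `r` for each step, and each of the bounds is attained infinitely often. Here `u i` and `v j`
are the best weights of the walks from `i` to `c` and from `c` to `j`, with `c` a critical vertex;
a long walk that avoids `c` loses a fixed amount per step, hence is not competitive. -/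
theorem IsGeneric.exists_potentials {A : Mat k} (hA : IsGeneric A) (hrow : ∀ i, ∃ j, A i j ≠ ⊥)
    {n₀ : ℕ} (hprim : ∀ i j, ∃ x, IsWalk (List.replicate n₀ A) i j x) (i₀ : Fin k) :
    ∃ (r : ℝ) (u v : Fin k → ℝ) (N₀ : ℕ),
      (∀ N ≥ N₀, ∀ i j x, IsWalk (List.replicate N A) i j x → x ≤ N * r + u i + v j) ∧
      ∀ i j N₁, ∃ N ≥ N₁, IsWalk (List.replicate N A) i j (N * r + u i + v j) := by
  obtain ⟨x, hx⟩ := exists_isWalk_replicate_of_le hrow (Nat.le_add_right n₀ k)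
    (fun i => hprim i i₀) i₀
  obtain ⟨r, c, p, hp, hpk, hc, hr⟩ := exists_max_mean (Nat.le_add_left k n₀) hx
  choose u m hum hu using fun i => exists_max_weight hr ⟨n₀, hprim i c⟩
  choose v m' hvm hv using fun j => exists_max_weight hr ⟨n₀, hprim c j⟩
  obtain ⟨r', hr'r, hr'⟩ := exists_lt_forall_le (r := r) (finite_closed_means (deleteVertex A c)) <| by
    rintro _ ⟨b, l, y, hb, hbk, hy, rfl⟩
    have hb' : (0 : ℝ) < b := by exact_mod_cast hb
    rw [div_lt_iff₀' hb']
    exact hA.closed_lt hp hpk hc hr hb hbk hy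
  obtain ⟨C, hC⟩ := exists_forall_weight_le (A := deleteVertex A c) (r := r') <| by
    intro b l y hb hbk hy
    have hb' : (0 : ℝ) < b := by exact_mod_cast hb
    rw [← div_le_iff₀' hb']
    exact hr' _ ⟨b, l, y, hb, hbk, hy, rfl⟩
  obtain ⟨E, hE⟩ := (Set.finite_range fun e : Fin k × Fin k => u e.1 + v e.2).bddBelow
  obtain ⟨N₀, hN₀⟩ := exists_nat_gt ((C - E) / (r - r'))
  refine ⟨r, u, v, N₀, fun N hN i j x hx => ?_, fun i j N₁ => ?_⟩
  · rcases hx.deleteVertex_or c with h | ⟨a, b, y, z, rfl, rfl, hy, hz⟩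
    · have h₁ := hC N i j x h
      have h₂ : E ≤ u i + v j := hE ⟨(i, j), rfl⟩
      rw [div_lt_iff₀ (by linarith)] at hN₀
      have h₃ : (N₀ : ℝ) * (r - r') ≤ N * (r - r') := by
        have : (N₀ : ℝ) ≤ N := by exact_mod_cast hN
        gcongr
      linarith
    · have h₁ := hu i a y hy
      have h₂ := hv j b z hz
      push_cast
      linarith
  -- Go from `i` to `c`, then around the critical closed walk `N₁` times, then from `c` to `j`.
  · refine ⟨m i + N₁ * p + m' j, ?_, ?_⟩
    · have := Nat.le_mul_of_pos_right N₁ hp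
      omega
    · convert ((hum i).replicate_add (hc.replicate_mul N₁)).replicate_add (hvm j) using 1
      push_cast
      ring

/-! ### A word with a dominant loop -/

/-- Up to the diagonal change of coordinates by `u` and the factor `θ`, the product of the word `w`
has entries at most `0`, with equality at the diagonal position `(d, d)` and a uniform negative bound
outside the column `d`; all the entries of the column `d` are finite. -/
structure HasDominantLoop (w : List (Mat k)) (d : Fin k) (u : Fin k → ℝ) (θ δ : ℝ) : Prop where
  pos : 0 < δ
  loop : IsWalk w d d θ
  reach : ∀ i, ∃ x, IsWalk w i d x
  le : ∀ i j x, IsWalk w i j x → x ≤ u i - u j + θ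
  le_sub : ∀ i j x, j ≠ d → IsWalk w i j x → x ≤ u i - u j + θ - δ

/-- If `A` has a long power close to the matrix of rank one of entries `u i + v j`, then so has
`A ^ N ⊗ B`, and the column in which `v l + B l d + u d` is maximal carries a dominant loop. The
exponent `N` is chosen to make the bound sharp at the relevant entry. -/
theorem exists_hasDominantLoop {A B : Mat k} (hrow : ∀ i, ∃ j, A i j ≠ ⊥)
    {n₀ : ℕ} (hprim : ∀ i j, ∃ x, IsWalk (List.replicate n₀ A) i j x) {r : ℝ} {u v : Fin k → ℝ}
    {N₀ : ℕ}
    (hle : ∀ N ≥ N₀, ∀ i j x, IsWalk (List.replicate N A) i j x → x ≤ N * r + u i + v j)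
    (heq : ∀ i j N₁, ∃ N ≥ N₁, IsWalk (List.replicate N A) i j (N * r + u i + v j))
    (hB : ∃ l j, B l j ≠ ⊥)
    (hne : ∀ l j l' j' (b b' : ℝ), j ≠ j' → B l j = (b : Rmax) → B l' j' = (b' : Rmax) →
      v l + b + u j ≠ v l' + b' + u j') :
    ∃ N d θ δ, HasDominantLoop (List.replicate N A ++ [B]) d u θ δ := by
  obtain ⟨l₁, j₁, h₁⟩ := hB
  obtain ⟨⟨l₀, d⟩, hmem, hmax⟩ := Set.exists_max_image {e : Fin k × Fin k | B e.1 e.2 ≠ ⊥}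
    (fun e => v e.1 + (B e.1 e.2).unbotD 0 + u e.2) (Set.toFinite _) ⟨(l₁, j₁), h₁⟩
  obtain ⟨β, hβ⟩ := WithBot.ne_bot_iff_exists.1 hmem
  have hmax' : ∀ l j (b : ℝ), B l j = (b : Rmax) → v l + b + u j ≤ v l₀ + β + u d := by
    intro l j b hb
    have := hmax (l, j) (by simp [hb])
    simpa [hb, ← hβ] using this
  obtain ⟨t, ht, htle⟩ := exists_lt_forall_le (r := v l₀ + β + u d)
    (s := (fun e : Fin k × Fin k => v e.1 + (B e.1 e.2).unbotD 0 + u e.2) ''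
      {e | e.2 ≠ d ∧ B e.1 e.2 ≠ ⊥}) (Set.toFinite _) <| by
    rintro _ ⟨⟨l, j⟩, ⟨hj, hlj⟩, rfl⟩
    obtain ⟨b, hb⟩ := WithBot.ne_bot_iff_exists.1 hlj
    have := (hmax' l j b hb.symm).lt_of_ne (hne _ _ _ _ _ _ hj hb.symm hβ.symm)
    simpa [← hb] using this
  -- `N ≥ n₀` keeps the entries of `A ^ N` finite, so that column `d` of the product is finite.
  obtain ⟨N, hN, hNw⟩ := heq d l₀ (N₀ + n₀)
  have hBd : IsWalk [B] l₀ d β := isWalk_singleton.2 hβ.symm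
  refine ⟨N, d, N * r + (v l₀ + β + u d), v l₀ + β + u d - t, by linarith, ?_, fun i => ?_, ?_, ?_⟩
  · convert hNw.append hBd using 1
    ring
  · obtain ⟨x, hx⟩ := exists_isWalk_replicate_of_le hrow (by omega : n₀ ≤ N)
      (fun i => hprim i l₀) i
    exact ⟨_, hx.append hBd⟩
  · intro i j x hx
    obtain ⟨l, y, b, hy, hb, rfl⟩ := hx.exists_of_append
    have h₁ := hle N (by omega) i l y hy
    have h₂ := hmax' l j b (isWalk_singleton.1 hb)
    linarith
  · intro i j x hj hx
    obtain ⟨l, y, b, hy, hb, rfl⟩ := hx.exists_of_append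
    have h₁ := hle N (by omega) i l y hy
    have hb' := isWalk_singleton.1 hb
    have h₂ := htle _ ⟨(l, j), ⟨hj, by simp [hb']⟩, rfl⟩
    simp only [hb', WithBot.unbotD_coe] at h₂
    linarith

/-! ### Powers of a word with a dominant loop -/

/-- The concatenation of `n` copies of the word `w`. -/
def wordPow (w : List (Mat k)) : ℕ → List (Mat k)
  | 0 => []
  | n + 1 => wordPow w n ++ w

theorem wordPow_succ' (w : List (Mat k)) (n : ℕ) : wordPow w (n + 1) = w ++ wordPow w n := by
  induction n with
  | zero => simp [wordPow]
  | succ n ih =>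
    calc wordPow w (n + 1 + 1) = wordPow w (n + 1) ++ w := rfl
      _ = w ++ wordPow w n ++ w := by rw [ih]
      _ = w ++ wordPow w (n + 1) := List.append_assoc _ _ _

theorem mem_of_mem_wordPow {w : List (Mat k)} {n : ℕ} {A : Mat k} (h : A ∈ wordPow w n) :
    A ∈ w := by
  induction n with
  | zero => simp [wordPow] at h
  | succ n ih =>
    rcases List.mem_append.1 h with h | h
    exacts [ih h, h]

namespace HasDominantLoop

variable {w : List (Mat k)} {d : Fin k} {u : Fin k → ℝ} {θ δ : ℝ}

/-- Along a high power of `w`, ending at `d` is strictly better than ending elsewhere. -/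
theorem eventually_lt (h : HasDominantLoop w d u θ δ) :
    ∀ᶠ n in Filter.atTop, ∀ i, (∃ y, IsWalk (wordPow w n) i d y) ∧
      ∀ l x, l ≠ d → IsWalk (wordPow w n) i l x →
        ∃ y, IsWalk (wordPow w n) i d y ∧ x + u l < y + u d := by
  have key : ∀ n i l x, l ≠ d → IsWalk (wordPow w n) i l x →
      (∃ y, IsWalk (wordPow w n) i d y ∧ x + u l ≤ y + u d - δ) ∨
        x + u l ≤ u i + n * (θ - δ) := by
    intro n
    induction n with
    | zero =>
      rintro i l x - ⟨rfl, rfl⟩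
      right
      simp
    | succ n ih =>
      intro i l x hl hx
      obtain ⟨m, y, z, hy, hz, rfl⟩ := hx.exists_of_append
      have hz' := h.le_sub m l z hl hz
      by_cases hm : m = d
      · subst hm
        exact Or.inl ⟨y + θ, hy.append h.loop, by linarith⟩
      · rcases ih i m y hm hy with ⟨y', hy', hle⟩ | hle
        · exact Or.inl ⟨y' + θ, hy'.append h.loop, by linarith [h.pos]⟩
        · right
          push_cast
          linarith
  choose g hg using h.reach
  have hpow : ∀ n i, IsWalk (wordPow w (n + 1)) i d (g i + n * θ) := by
    intro n i
    induction n with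
    | zero => simpa [wordPow] using hg i
    | succ n ih =>
      have := ih.append h.loop
      rwa [add_assoc, ← add_one_mul, ← Nat.cast_succ] at this
  obtain ⟨C, hC⟩ := (Set.finite_range fun i => u i - (g i + u d)).bddAbove
  obtain ⟨n₀, hn₀⟩ := exists_nat_gt ((C + θ) / δ)
  rw [div_lt_iff₀ h.pos] at hn₀
  filter_upwards [Filter.eventually_ge_atTop (n₀ + 1)] with n hn i
  obtain ⟨n, rfl⟩ : ∃ m, n = m + 1 := ⟨n - 1, by omega⟩
  refine ⟨⟨_, hpow n i⟩, fun l x hl hx => ?_⟩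
  rcases key _ i l x hl hx with ⟨y, hy, hle⟩ | hle
  · exact ⟨y, hy, by linarith [h.pos]⟩
  · refine ⟨_, hpow n i, ?_⟩
    have h₁ : u i - (g i + u d) ≤ C := hC ⟨i, rfl⟩
    have h₂ : (n₀ : ℝ) * δ ≤ n * δ := by
      have : (n₀ : ℝ) ≤ n := by exact_mod_cast (by omega : n₀ ≤ n)
      have := h.pos
      gcongr
    have := h.pos
    push_cast at hle
    linarith

/-- Along a high power of `w` followed by a fixed word, starting at `d` is at least as good as
starting elsewhere. -/
theorem eventually_le (h : HasDominantLoop w d u θ δ) {w' : List (Mat k)}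
    (hw' : ∀ j, ∃ x, IsWalk w' d j x) :
    ∀ᶠ n in Filter.atTop, ∀ j, (∃ y, IsWalk (wordPow w n ++ w') d j y) ∧
      ∀ l x, IsWalk (wordPow w n ++ w') l j x →
        ∃ y, IsWalk (wordPow w n ++ w') d j y ∧ x - u l ≤ y - u d := by
  obtain ⟨C, hC⟩ := (Set.finite_iUnion fun l => Set.finite_iUnion fun j =>
    (finite_isWalk w' l j).image fun x => x - u l).bddAbove
  have key : ∀ n l j x, IsWalk (wordPow w n ++ w') l j x →
      (∃ y, IsWalk (wordPow w n ++ w') d j y ∧ x - u l ≤ y - u d) ∨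
        x - u l ≤ C + n * (θ - δ) := by
    intro n
    induction n with
    | zero =>
      intro l j x hx
      right
      simpa using hC (Set.mem_iUnion.2 ⟨l, Set.mem_iUnion.2 ⟨j, x, hx, rfl⟩⟩)
    | succ n ih =>
      intro l j x hx
      rw [wordPow_succ', List.append_assoc] at hx ⊢
      obtain ⟨m, z, y, hz, hy, rfl⟩ := hx.exists_of_append
      by_cases hm : m = d
      · subst hm
        have hz' := h.le l m z hz
        exact Or.inl ⟨θ + y, h.loop.append hy, by linarith⟩
      · have hz' := h.le_sub l m z hm hz
        rcases ih m j y hy with ⟨y', hy', hle⟩ | hle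
        · exact Or.inl ⟨θ + y', h.loop.append hy', by linarith [h.pos]⟩
        · right
          push_cast
          linarith
  choose g hg using hw'
  have hpow : ∀ n j, IsWalk (wordPow w n ++ w') d j (n * θ + g j) := by
    intro n j
    induction n with
    | zero => simpa [wordPow] using hg j
    | succ n ih =>
      rw [wordPow_succ', List.append_assoc]
      convert h.loop.append ih using 1
      push_cast
      ring
  obtain ⟨C', hC'⟩ := (Set.finite_range fun j => u d - g j).bddAbove
  obtain ⟨n₀, hn₀⟩ := exists_nat_gt ((C + C') / δ)
  rw [div_lt_iff₀ h.pos] at hn₀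
  filter_upwards [Filter.eventually_ge_atTop n₀] with n hn j
  refine ⟨⟨_, hpow n j⟩, fun l x hx => ?_⟩
  rcases key n l j x hx with h' | hle
  · exact h'
  · refine ⟨_, hpow n j, ?_⟩
    have h₁ : u d - g j ≤ C' := hC' ⟨j, rfl⟩
    have h₂ : (n₀ : ℝ) * δ ≤ n * δ := by
      have : (n₀ : ℝ) ≤ n := by exact_mod_cast hn
      have := h.pos
      gcongr
    linarith

/-- All the optimal walks along a suitable product pass through `d` at an intermediate time. -/
theorem exists_separating (h : HasDominantLoop w d u θ δ) {w' : List (Mat k)}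
    (hw' : ∀ j, ∃ x, IsWalk w' d j x) :
    ∃ n, (∀ i, ∃ x, IsWalk (wordPow w n) i d x) ∧
      (∀ j, ∃ x, IsWalk (wordPow w n ++ w') d j x) ∧
      ∀ i l j x y, l ≠ d → IsWalk (wordPow w n) i l x → IsWalk (wordPow w n ++ w') l j y →
        ∃ x' y', IsWalk (wordPow w n) i d x' ∧ IsWalk (wordPow w n ++ w') d j y' ∧
          x + y < x' + y' := by
  obtain ⟨n, h₁, h₂⟩ := (h.eventually_lt.and (h.eventually_le hw')).exists
  refine ⟨n, fun i => (h₁ i).1, fun j => (h₂ j).1, fun i l j x y hl hx hy => ?_⟩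
  obtain ⟨x', hx', hlt⟩ := (h₁ i).2 l x hl hx
  obtain ⟨y', hy', hle⟩ := (h₂ j).2 l y hy
  exact ⟨x', y', hx', hy', by linarith⟩

end HasDominantLoop

/-! ### Choice of the matrices -/

/-- A set that no finite union of hyperplanes covers has elements outside any finite union of
hyperplanes. -/
theorem exists_forall_linearForm_ne {S : Set (M k)}
    (hS : ¬ ∃ F : Set (Set (M k)), F.Finite ∧ (∀ H ∈ F, IsAffineHyperplaneOfP H) ∧ S ∩ P k ⊆ ⋃₀ F)
    {s : Set ((Fin k × Fin k → ℝ) × ℝ)} (hs : s.Finite) (h0 : ∀ q ∈ s, q.1 ≠ 0) :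
    ∃ A ∈ S ∩ P k, ∀ q ∈ s, linearForm q.1 (fun e => A.val e.1 e.2) ≠ (q.2 : Rmax) := by
  by_contra! hcon
  refine hS ⟨(fun q : (Fin k × Fin k → ℝ) × ℝ =>
    {A : M k | A ∈ P k ∧ linearForm q.1 (fun e => A.val e.1 e.2) = (q.2 : Rmax)}) '' s,
    hs.image _, ?_, fun A hA => ?_⟩
  · rintro _ ⟨q, hq, rfl⟩
    exact ⟨_, ⟨q.1, q.2, h0 q hq, rfl⟩, rfl⟩
  · obtain ⟨q, hq, hqA⟩ := hcon A hA
    exact ⟨_, ⟨q, hq, rfl⟩, hA.2, hqA⟩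

theorem linearForm_single_sub_single {e e' : Fin k × Fin k} (hee' : e ≠ e') {B : Mat k} {b b' : ℝ}
    (hb : B e.1 e.2 = (b : Rmax)) (hb' : B e'.1 e'.2 = (b' : Rmax)) :
    linearForm (Pi.single e 1 - Pi.single e' 1) (fun e => B e.1 e.2) = ((b - b' : ℝ) : Rmax) := by
  have hfin : ∀ q, (Pi.single e 1 - Pi.single e' 1 : Fin k × Fin k → ℝ) q ≠ 0 → B q.1 q.2 ≠ ⊥ := by
    intro q hq
    by_cases h : q = e
    · subst h; simp [hb]
    · by_cases h' : q = e'
      · subst h'; simp [hb']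
      · simp [h, h'] at hq
  rw [linearForm_eq_sum hfin]
  congr 1
  simp [sub_mul, Finset.sum_sub_distrib, Pi.single_apply, hb, hb']

/-- Two words in the elements of `S`, and a vertex `d` through which all the optimal walks along
their concatenation pass between the two words. -/
theorem exists_separating_words (hk : 1 ≤ k) {S : Set (M k)}
    (hS : ¬ ∃ F : Set (Set (M k)), F.Finite ∧ (∀ H ∈ F, IsAffineHyperplaneOfP H) ∧
      S ∩ P k ⊆ ⋃₀ F) :
    ∃ (w₁ w₂ : List (Mat k)) (d : Fin k), (∀ X ∈ w₁ ++ w₂, ∃ A ∈ S ∩ P k, A.val = X) ∧ w₂ ≠ [] ∧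
      (∀ i, ∃ x, IsWalk w₁ i d x) ∧ (∀ j, ∃ x, IsWalk w₂ d j x) ∧
      ∀ i l j x y, l ≠ d → IsWalk w₁ i l x → IsWalk w₂ l j y →
        ∃ x' y', IsWalk w₁ i d x' ∧ IsWalk w₂ d j y' ∧ x + y < x' + y' := by
  obtain ⟨A, hA, hAgen⟩ := exists_forall_linearForm_ne hS
    (s := (fun α : Fin k × Fin k → ℤ => ((fun e => (α e : ℝ)), (0 : ℝ))) ''
      (Set.Icc (fun _ => -((k : ℤ) * k)) (fun _ => (k : ℤ) * k) \ {0}))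
    (((Set.finite_Icc _ _).subset Set.sdiff_subset).image _) <| by
      rintro _ ⟨α, ⟨-, hα⟩, rfl⟩ h0
      refine hα (funext fun e => ?_)
      have h : ((α e : ℤ) : ℝ) = 0 := congrFun h0 e
      exact_mod_cast h
  have hgen : IsGeneric A.val := fun α hα h0 => hAgen _ ⟨α, ⟨hα, h0⟩, rfl⟩
  obtain ⟨n₀, hn₀, hpow⟩ := hA.2
  have hprim : ∀ i j, ∃ x, IsWalk (List.replicate n₀ A.val) i j x := fun i j =>
    exists_isWalk_iff.2 (by rw [listProd_replicate]; exact hpow i j)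
  obtain ⟨r, u, v, N₀, hle, heq⟩ := hgen.exists_potentials A.row_ne hprim ⟨0, hk⟩
  obtain ⟨B, hB, hBgen⟩ := exists_forall_linearForm_ne hS
    (s := (fun q : (Fin k × Fin k) × (Fin k × Fin k) =>
      ((Pi.single q.1 1 - Pi.single q.2 1 : Fin k × Fin k → ℝ),
        v q.2.1 + u q.2.2 - v q.1.1 - u q.1.2)) '' {q | q.1 ≠ q.2}) (Set.toFinite _) <| by
      rintro _ ⟨⟨e, e'⟩, hne, rfl⟩ h0
      have hne' : e ≠ e' := hne
      simpa [hne'] using congrFun h0 e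
  obtain ⟨N, d, θ, δ, hD⟩ := exists_hasDominantLoop A.row_ne hprim hle heq (B := B.val)
    ⟨⟨0, hk⟩, B.row_ne _⟩ <| by
      intro l j l' j' b b' hj hb hb' h
      have hne : (l, j) ≠ (l', j') := fun h => hj (Prod.ext_iff.1 h).2
      refine hBgen _ ⟨((l, j), (l', j')), hne, rfl⟩ ?_
      rw [linearForm_single_sub_single hne hb hb']
      exact congrArg _ (by linarith)
  -- The final factor `A ^ n₀` makes the whole row `d` finite, which the word for `D` need not do.
  obtain ⟨n, h₁, h₂, h₃⟩ := hD.exists_separating (w' := List.replicate n₀ A.val) (hprim d)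
  refine ⟨_, _, d, ?_, ?_, h₁, h₂, h₃⟩
  · have hword : ∀ X ∈ wordPow (List.replicate N A.val ++ [B.val]) n, ∃ A ∈ S ∩ P k, A.val = X := by
      intro X hX
      rcases List.mem_append.1 (mem_of_mem_wordPow hX) with h | h
      · exact ⟨A, hA, (List.eq_of_mem_replicate h).symm⟩
      · exact ⟨B, hB, (List.mem_singleton.1 h).symm⟩
    intro X hX
    rcases List.mem_append.1 hX with h | h
    · exact hword X h
    · rcases List.mem_append.1 h with h | h
      · exact hword X h
      · exact ⟨A, hA, (List.eq_of_mem_replicate h).symm⟩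
  · simp only [ne_eq, List.append_eq_nil_iff, not_and]
    intro _ h
    have := congrArg List.length h
    simp at this
    omega

end Words

section Probability

variable {k : ℕ}

/-! ### Exponential coordinates -/

/-- The exponential from the max-plus semiring to `ℝ≥0`, with `exp (-∞) = 0`: it turns max-plus sums
and products into maxima and ordinary products, which are continuous. -/
noncomputable def toNNReal : Rmax → NNReal
  | ⊥ => 0
  | (x : ℝ) => ⟨Real.exp x, (Real.exp_pos x).le⟩

@[simp] theorem toNNReal_bot : toNNReal ⊥ = 0 := rfl

theorem coe_toNNReal_coe (x : ℝ) : (toNNReal (x : Rmax) : ℝ) = Real.exp x := rfl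

theorem toNNReal_strictMono : StrictMono toNNReal := by
  intro x y h
  induction y using WithBot.recBotCoe with
  | bot => simp at h
  | coe y =>
    induction x using WithBot.recBotCoe with
    | bot => exact NNReal.coe_pos.1 (Real.exp_pos y)
    | coe x =>
      rw [← NNReal.coe_lt_coe, coe_toNNReal_coe, coe_toNNReal_coe]
      exact Real.exp_lt_exp.2 (WithBot.coe_lt_coe.1 h)

theorem toNNReal_add (x y : Rmax) : toNNReal (x + y) = toNNReal x * toNNReal y := by
  induction x using WithBot.recBotCoe with
  | bot => simp
  | coe x =>
    induction y using WithBot.recBotCoe with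
    | bot => simp
    | coe y =>
      exact NNReal.eq (Real.exp_add x y)

theorem toNNReal_mul (A B : Mat k) (i j : Fin k) :
    toNNReal (mul A B i j) = Finset.univ.sup fun l => toNNReal (A i l) * toNNReal (B l j) := by
  rw [mul, Finset.apply_sup_eq_sup_comp toNNReal toNNReal_strictMono.monotone.map_sup rfl]
  exact Finset.sup_congr rfl fun l _ => toNNReal_add _ _

/-- The exponential as a function of the arctangent. -/
noncomputable def expTan (t : ℝ) : ℝ :=
  if t ≤ -(Real.pi / 2) then 0 else Real.exp (Real.tan t)

theorem expTan_arctan (x : Rmax) : expTan (arctan x) = toNNReal x := by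
  induction x using WithBot.recBotCoe with
  | bot => simp [expTan, arctan]
  | coe x =>
    have : arctan (x : Rmax) = Real.arctan x := rfl
    rw [this, expTan, if_neg (not_le.2 (Real.neg_pi_div_two_lt_arctan x)), Real.tan_arctan]
    rfl

theorem continuousOn_expTan : ContinuousOn expTan (Set.Iio (Real.pi / 2)) := by
  intro t ht
  refine ContinuousAt.continuousWithinAt ?_
  have hright : ∀ s : ℝ, -(Real.pi / 2) < s → expTan s = Real.exp (Real.tan s) :=
    fun s hs => if_neg (not_le.2 hs)
  have hleft : ∀ s : ℝ, s ≤ -(Real.pi / 2) → expTan s = 0 := fun s hs => if_pos hs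
  rcases lt_trichotomy t (-(Real.pi / 2)) with h | h | h
  · refine (continuousAt_const (y := (0 : ℝ))).congr ?_
    filter_upwards [Iio_mem_nhds h] with s hs
    exact (hleft s (le_of_lt hs)).symm
  · subst h
    refine continuousAt_iff_continuous_left_right.2 ⟨?_, ?_⟩
    · exact (continuousWithinAt_const (b := (0 : ℝ))).congr (fun s hs => hleft s hs)
        (hleft _ le_rfl)
    · rw [← continuousWithinAt_Ioi_iff_Ici, ContinuousWithinAt, hleft _ le_rfl]
      refine (Real.tendsto_exp_atBot.comp Real.tendsto_tan_neg_pi_div_two).congr' ?_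
      filter_upwards [self_mem_nhdsWithin] with s hs
      exact (hright s hs).symm
  · have hcos : Real.cos t ≠ 0 := (Real.cos_pos_of_mem_Ioo ⟨h, ht⟩).ne'
    refine (Real.continuous_exp.continuousAt.comp (Real.continuousAt_tan.2 hcos)).congr ?_
    filter_upwards [Ioi_mem_nhds h] with s hs
    exact (hright s hs).symm

theorem arctan_lt (x : Rmax) : arctan x < Real.pi / 2 := by
  induction x using WithBot.recBotCoe with
  | bot =>
    have : arctan ⊥ = -(Real.pi / 2) := rfl
    linarith [Real.pi_pos]
  | coe x => exact Real.arctan_lt_pi_div_two x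

theorem continuous_toNNReal_val (i j : Fin k) : Continuous fun A : M k => toNNReal (A.val i j) := by
  have h : Continuous fun A : M k => arctan (A.val i j) :=
    (continuous_apply j).comp ((continuous_apply i).comp
      (continuous_induced_dom (f := (arctanEntries : M k → Fin k → Fin k → ℝ))))
  refine NNReal.isEmbedding_coe.continuous_iff.2 <|
    (continuousOn_expTan.comp_continuous h fun A => arctan_lt _).congr fun A => ?_
  exact expTan_arctan _

theorem continuous_toNNReal_prod (N : ℕ) (i j : Fin k) :
    Continuous fun f : ℕ → M k => toNNReal (prod f N i j) := by
  induction N generalizing i with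
  | zero => exact continuous_const (y := toNNReal (one k i j))
  | succ N ih =>
    simp only [prod, toNNReal_mul]
    exact Continuous.finset_sup_apply fun l _ =>
      ((continuous_toNNReal_val i l).comp (continuous_apply (N + 1))).mul (ih l)

/-! ### Products along sequences -/

theorem mul_assoc (A B C : Mat k) : mul (mul A B) C = mul A (mul B C) := by
  funext i j
  refine le_antisymm (Finset.sup_le fun l _ => ?_) (Finset.sup_le fun l _ => ?_)
  · obtain ⟨m, hm⟩ := exists_mul_eq A B i l
    simp only [hm, add_assoc]
    exact (add_le_add_right (le_mul B C m l j) (A i m)).trans (le_mul A (mul B C) i m j)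
  · obtain ⟨m, hm⟩ := exists_mul_eq B C l j
    simp only [hm, ← add_assoc]
    exact (add_le_add_left (le_mul A B i l m) (C m j)).trans (le_mul (mul A B) C i m j)

theorem one_mul (A : Mat k) : mul (one k) A = A := by
  funext i j
  refine le_antisymm (Finset.sup_le fun l _ => ?_) ?_
  · by_cases h : i = l
    · simp [one, h]
    · simp [one, h]
  · simpa [one] using le_mul (one k) A i i j

theorem prod_congr {f g : ℕ → M k} {N : ℕ} (h : ∀ n, 1 ≤ n → n ≤ N → f n = g n) :
    prod f N = prod g N := by
  induction N with
  | zero => rfl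
  | succ N ih =>
    rw [prod, prod, h (N + 1) (by omega) le_rfl, ih fun n h₁ h₂ => h n h₁ (by omega)]

theorem prod_add (f : ℕ → M k) (m n : ℕ) :
    prod f (m + n) = mul (prod (fun t => f (n + t)) m) (prod f n) := by
  induction m with
  | zero => rw [Nat.zero_add]; exact (one_mul _).symm
  | succ m ih =>
    rw [Nat.add_right_comm]
    simp only [prod]
    rw [ih, mul_assoc, Nat.add_right_comm m n 1, Nat.add_comm (m + 1) n]

/-- Any list of matrices is read off backwards by some sequence, from the index `1` on. -/
theorem exists_seq {S : Set (M k)} (hne : S.Nonempty) {w : List (Mat k)}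
    (hw : ∀ X ∈ w, ∃ A ∈ S, A.val = X) :
    ∃ f : ℕ → M k, (∀ n, f n ∈ S) ∧ prod f w.length = listProd w := by
  induction w with
  | nil =>
    obtain ⟨A, hA⟩ := hne
    exact ⟨fun _ => A, fun _ => hA, rfl⟩
  | cons X w ih =>
    obtain ⟨f, hf, hfw⟩ := ih fun Y hY => hw Y (List.mem_cons_of_mem _ hY)
    obtain ⟨A, hA, rfl⟩ := hw X List.mem_cons_self
    refine ⟨Function.update f (w.length + 1) A, fun n => ?_, ?_⟩
    · by_cases h : n = w.length + 1
      · simpa [h] using hA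
      · simpa [h] using hf n
    · rw [List.length_cons, prod, listProd_cons, Function.update_self, ← hfw]
      congr 1
      exact prod_congr fun n _ h => Function.update_of_ne (by omega) _ _

/-- The product of two matrices has rank one if one column of the first factor and the corresponding
row of the second one yield all the maxima. -/
theorem rankOne_mul {A B : Mat k} {d : Fin k} (hA : A d d ≠ ⊥) (hB : B d d ≠ ⊥)
    (h : ∀ i j l, A i l + B l j ≤ A i d + B d j) : RankOne (mul A B) :=
  ⟨fun i => A i d, fun j => B d j, ⟨d, hA⟩, ⟨d, hB⟩, fun i j =>
    le_antisymm (Finset.sup_le fun l _ => h i j l) (le_mul A B i d j)⟩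

/-- If `S` is not covered by finitely many hyperplanes, some open set of sequences that meets
`S ^ ℕ` consists of sequences with a product of rank one. -/
theorem exists_isOpen_rankOne (hk : 1 ≤ k) {S : Set (M k)}
    (hS : ¬ ∃ F : Set (Set (M k)), F.Finite ∧ (∀ H ∈ F, IsAffineHyperplaneOfP H) ∧
      S ∩ P k ⊆ ⋃₀ F) :
    ∃ (N : ℕ) (U : Set (ℕ → M k)) (f : ℕ → M k), 1 ≤ N ∧ IsOpen U ∧ f ∈ U ∧
      (∀ n, f n ∈ S ∩ P k) ∧ ∀ g ∈ U, RankOne (prod g N) := by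
  have hne : (S ∩ P k).Nonempty := by
    rw [Set.nonempty_iff_ne_empty]
    intro h
    exact hS ⟨∅, Set.finite_empty, by simp, by simp [h]⟩
  obtain ⟨w₁, w₂, d, hmem, hnil, h₁, h₂, hlt⟩ := exists_separating_words hk hS
  obtain ⟨f₂, hf₂, hfw₂⟩ := exists_seq hne fun X hX => hmem X (List.mem_append_right w₁ hX)
  obtain ⟨f₁, hf₁, hfw₁⟩ := exists_seq hne fun X hX => hmem X (List.mem_append_left w₂ hX)
  set m := w₁.length
  set n := w₂.length
  let L (g : ℕ → M k) : Mat k := prod (fun t => g (n + t)) m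
  let R (g : ℕ → M k) : Mat k := prod g n
  have hL : ∀ i j, Continuous fun g : ℕ → M k => toNNReal (L g i j) := fun i j =>
    (continuous_toNNReal_prod m i j).comp
      (continuous_pi fun t => continuous_apply (n + t))
  have hR : ∀ i j, Continuous fun g : ℕ → M k => toNNReal (R g i j) := fun i j =>
    continuous_toNNReal_prod n i j
  let f : ℕ → M k := fun t => if t ≤ n then f₂ t else f₁ (t - n)
  have hLf : L f = listProd w₁ := by
    rw [← hfw₁]
    refine prod_congr fun t ht _ => ?_
    simp only [f]
    rw [if_neg (by omega), Nat.add_sub_cancel_left]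
  have hRf : R f = listProd w₂ := by
    rw [← hfw₂]
    exact prod_congr fun t _ ht => if_pos ht
  refine ⟨m + n, {g | (0 < toNNReal (L g d d) ∧ 0 < toNNReal (R g d d)) ∧ ∀ i j l, l ≠ d →
    toNNReal (L g i l) * toNNReal (R g l j) < toNNReal (L g i d) * toNNReal (R g d j)}, f, ?_, ?_,
    ?_, fun t => ?_, ?_⟩
  · have := List.length_pos_iff.2 hnil
    omega
  · simp only [Set.ofPred_and, Set.ofPred_forall]
    refine ((isOpen_lt continuous_const (hL d d)).inter
      (isOpen_lt continuous_const (hR d d))).inter ?_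
    exact isOpen_iInter_of_finite fun i => isOpen_iInter_of_finite fun j =>
      isOpen_iInter_of_finite fun l => isOpen_iInter_of_finite fun _ =>
        isOpen_lt ((hL i l).mul (hR l j)) ((hL i d).mul (hR d j))
  · have hpos : ∀ {x : Rmax}, x ≠ ⊥ → 0 < toNNReal x := fun hx => by
      rw [← toNNReal_bot]
      exact toNNReal_strictMono (bot_lt_iff_ne_bot.2 hx)
    refine ⟨⟨hpos ?_, hpos ?_⟩, fun i j l hl => ?_⟩
    · rw [hLf]; exact exists_isWalk_iff.1 (h₁ d)
    · rw [hRf]; exact exists_isWalk_iff.1 (h₂ d)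
    · rw [← toNNReal_add, ← toNNReal_add, hLf, hRf]
      refine toNNReal_strictMono ?_
      by_cases hx : listProd w₁ i l = ⊥
      · rw [hx, WithBot.bot_add, bot_lt_iff_ne_bot, Ne, WithBot.add_eq_bot, not_or]
        exact ⟨exists_isWalk_iff.1 (h₁ i), exists_isWalk_iff.1 (h₂ j)⟩
      by_cases hy : listProd w₂ l j = ⊥
      · rw [hy, WithBot.add_bot, bot_lt_iff_ne_bot, Ne, WithBot.add_eq_bot, not_or]
        exact ⟨exists_isWalk_iff.1 (h₁ i), exists_isWalk_iff.1 (h₂ j)⟩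
      obtain ⟨x, hx⟩ := WithBot.ne_bot_iff_exists.1 hx
      obtain ⟨y, hy⟩ := WithBot.ne_bot_iff_exists.1 hy
      obtain ⟨x', y', hx', hy', hlt⟩ :=
        hlt i l j x y hl (.of_listProd_eq hx.symm) (.of_listProd_eq hy.symm)
      rw [← hx, ← hy]
      calc (x : Rmax) + y < x' + y' := by exact_mod_cast hlt
        _ ≤ _ := add_le_add hx'.le_listProd hy'.le_listProd
  · simp only [f]
    split_ifs
    exacts [hf₂ t, hf₁ _]
  · rintro g ⟨⟨h₁, h₂⟩, h⟩
    rw [prod_add]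
    refine rankOne_mul (d := d) (fun h => ?_) (fun h => ?_) fun i j l => ?_
    · exact h₁.ne' (by simp [L, h])
    · exact h₂.ne' (by simp [R, h])
    · by_cases hl : l = d
      · rw [hl]
      · rw [← toNNReal_strictMono.le_iff_le, toNNReal_add, toNNReal_add]
        exact (h i j l hl).le

/-! ### Positive probability -/

variable {Ω : Type*} [MeasurableSpace Ω]

/-- For an independent sequence, the support of the law of `(A 1, …, A N)` contains the product of
the supports. -/
theorem mem_support_lawUpTo {μ : Measure (M k)} {Pr : Measure Ω} [IsProbabilityMeasure Pr]
    {A : ℕ → Ω → M k} (hA : ∀ n, Measurable (A n)) (hind : iIndepFun A Pr)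
    (hlaw : ∀ n, Pr.map (A n) = μ) {N : ℕ} {B : Fin N → M k} (hB : ∀ i, B i ∈ μ.support) :
    B ∈ (lawUpTo Pr A N).support := by
  have hmeas : Measurable fun ω (i : Fin N) => A ((i : ℕ) + 1) ω :=
    measurable_pi_lambda _ fun i => hA _
  refine (Measure.mem_support_iff_forall B).2 fun U hU => ?_
  obtain ⟨V, hVU, hV, hBV⟩ := mem_nhds_iff.1 hU
  obtain ⟨I, u, hu, huV⟩ := isOpen_pi_iff.1 hV B hBV
  have hind' := (hind.precomp (g := fun i : Fin N => (i : ℕ) + 1) fun i j h => by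
    simpa [Fin.ext_iff] using h).measure_inter_preimage_eq_mul I (sets := u)
      fun i hi => (hu i hi).1.measurableSet
  have hbox : MeasurableSet ((I : Set (Fin N)).pi u) :=
    MeasurableSet.pi I.countable_toSet fun i hi => (hu i hi).1.measurableSet
  refine lt_of_lt_of_le ?_ (measure_mono (huV.trans hVU))
  rw [lawUpTo, Measure.map_apply hmeas hbox]
  have hset : (fun ω (i : Fin N) => A ((i : ℕ) + 1) ω) ⁻¹' ((I : Set (Fin N)).pi u) =
      ⋂ i ∈ I, A ((i : ℕ) + 1) ⁻¹' u i := by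
    ext ω
    simp [Set.mem_pi]
  rw [hset, hind', pos_iff_ne_zero, Finset.prod_ne_zero_iff]
  intro i hi
  rw [← Measure.map_apply (hA _) (hu i hi).1.measurableSet, hlaw]
  exact ((Measure.mem_support_iff_forall _).1 (hB i) _
    ((hu i hi).1.mem_nhds (hu i hi).2)).ne'

/-- The memory loss property holds as soon as the products of the set `S` lie in the supports of the
laws of the finite subsequences. -/
theorem MLP.of_subset_support (hk : 1 ≤ k) {S : Set (M k)}
    (hS : ¬ ∃ F : Set (Set (M k)), F.Finite ∧ (∀ H ∈ F, IsAffineHyperplaneOfP H) ∧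
      S ∩ P k ⊆ ⋃₀ F) {Pr : Measure Ω} {A : ℕ → Ω → M k} (hA : ∀ n, Measurable (A n))
    (hsupp : ∀ N : ℕ, {B : Fin N → M k | ∀ i, B i ∈ S ∩ P k} ⊆ (lawUpTo Pr A N).support) :
    MLP Pr A := by
  obtain ⟨N, U, f, hN, hU, hfU, hf, hrank⟩ := exists_isOpen_rankOne hk hS
  refine ⟨N, hN, ?_⟩
  -- Only the terms of index `1, …, N` matter: the others are frozen to those of `f`.
  let e : (Fin N → M k) → ℕ → M k := fun B t =>
    if h : 1 ≤ t ∧ t ≤ N then B ⟨t - 1, by omega⟩ else f t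
  have he : Continuous e := by
    refine continuous_pi fun t => ?_
    by_cases h : 1 ≤ t ∧ t ≤ N
    · simp only [e, dif_pos h]
      exact continuous_apply _
    · simp only [e, dif_neg h]
      exact continuous_const
  let B : Fin N → M k := fun i => f (i + 1)
  have heB : e B = f := by
    funext t
    by_cases h : 1 ≤ t ∧ t ≤ N
    · simp only [e, dif_pos h, B]
      rw [Nat.sub_add_cancel h.1]
    · simp only [e, dif_neg h]
  have hB : B ∈ e ⁻¹' U := by rwa [Set.mem_preimage, heB]
  obtain ⟨I, u, hu, huU⟩ := isOpen_pi_iff.1 (hU.preimage he) B hB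
  have hbox : IsOpen ((I : Set (Fin N)).pi u) := isOpen_set_pi I.finite_toSet fun i hi => (hu i hi).1
  have hpos := (Measure.mem_support_iff_forall B).1 (hsupp N fun i => hf (i + 1)) _
    (hbox.mem_nhds fun i hi => (hu i hi).2)
  have hmeas : Measurable fun ω (i : Fin N) => A ((i : ℕ) + 1) ω :=
    measurable_pi_lambda _ fun i => hA _
  rw [lawUpTo, Measure.map_apply hmeas
    (MeasurableSet.pi I.countable_toSet fun i hi => (hu i hi).1.measurableSet)] at hpos
  refine hpos.trans_le (measure_mono fun ω hω => ?_)
  have : prod (fun n => A n ω) N = prod (e fun i => A ((i : ℕ) + 1) ω) N := by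
    refine prod_congr fun t h₁ h₂ => ?_
    simp only [e, dif_pos (And.intro h₁ h₂)]
    rw [Nat.sub_add_cancel h₁]
  show RankOne _
  rw [this]
  exact hrank _ (huU hω)

end Probability

end MaxPlus

theorem theorem3 {k : ℕ} (hk : 1 ≤ k)
    (μ : Measure (MaxPlus.M k)) [IsProbabilityMeasure μ]
    (hμ : ¬ ∃ F : Set (Set (MaxPlus.M k)), F.Finite ∧
      (∀ H ∈ F, MaxPlus.IsAffineHyperplaneOfP H) ∧ μ.support ∩ MaxPlus.P k ⊆ ⋃₀ F)
    {Ω : Type*} [MeasurableSpace Ω] (Pr : Measure Ω) [IsProbabilityMeasure Pr]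
    (A : ℕ → Ω → MaxPlus.M k) (hA : ∀ n, Measurable (A n)) :
    (iIndepFun A Pr → (∀ n, Pr.map (A n) = μ) → MaxPlus.MLP Pr A) ∧
    (MaxPlus.IsStationary Pr A → Pr.map (A 1) = μ →
      (∀ N : ℕ, {B : Fin N → MaxPlus.M k | ∀ i, B i ∈ μ.support ∩ MaxPlus.P k} ⊆
        (MaxPlus.lawUpTo Pr A N).support) →
      MaxPlus.MLP Pr A) :=
  ⟨fun hind hlaw => .of_subset_support hk hμ hA fun _ _ hB =>
      MaxPlus.mem_support_lawUpTo hA hind hlaw fun i => (hB i).1,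
    fun _ _ hsupp => .of_subset_support hk hμ hA hsupp⟩
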